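/- Let $G$ be a finite simple graph with $n$ vertices, $e \ge 1$ edges, and exactly $r$ bipartite connected components (an isolated vertex counts as a bipartite component). Let $L(G)$ be the line graph of $G$: its vertices are the edges of $G$, and two distinct edges are adjacent if and only if they share a vertex in $G$. For a finite simple graph $H$, let $\mathrm{Rep}(H)$ denote the Euclidean representation number of $H$, i.e. the smallest $m \ge 0$ for which there exist an injective map $p : V(H) \to \mathbb{R}^m$ and distinct constants $\alpha, \beta > 0$ such that, for all distinct vertices $u, v$ of $H$, $\|p(u) - p(v)\| = \alpha$ if $u$ and $v$ are adjacent and $\|p(u) - p(v)\| = \beta$ otherwise. Then \[ \mathrm{Rep}(L(G)) \le n - 1 - r , \] and if moreover $e \ge 2(n - r)$, then $\mathrm{Rep}(L(G)) = n - 1 - r$. -/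

import Mathlib

namespace SimpleGraph

/-- `G` is representable in `ℝ^m`: its vertices embed in Euclidean `m`-space so that, for some
distinct positive constants `α` and `β`, adjacent vertices are at distance `α` and distinct
non-adjacent vertices are at distance `β`. -/
def EuclideanRepresentable {V : Type*} (G : SimpleGraph V) (m : ℕ) : Prop :=
  ∃ (p : V ↪ EuclideanSpace ℝ (Fin m)) (α β : ℝ), 0 < α ∧ 0 < β ∧ α ≠ β ∧
    ∀ u v : V, u ≠ v →
      (G.Adj u v → ‖p u - p v‖ = α) ∧ (¬ G.Adj u v → ‖p u - p v‖ = β)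

open Matrix MatrixOrder in
/-- Every finite graph is representable in some dimension, so that the infimum defining
`euclideanRep` below is a minimum. -/
theorem exists_euclideanRepresentable {V : Type*} [Finite V] (G : SimpleGraph V) :
    ∃ m : ℕ, G.EuclideanRepresentable m := by
  classical
  have := Fintype.ofFinite V
  -- The Laplacian plus a large diagonal is a Gram matrix with constant diagonal.
  let D : Matrix V V ℝ := Matrix.diagonal fun v => (Fintype.card V + 1 : ℝ) - G.degree v
  have hD : D.PosSemidef := by
    refine Matrix.PosSemidef.diagonal fun v => ?_
    have : (G.degree v : ℝ) < Fintype.card V := by exact_mod_cast G.degree_lt_card_verts v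
    simp only [Pi.zero_apply]
    linarith
  have hM : (G.lapMatrix ℝ + D).PosSemidef := (G.posSemidef_lapMatrix ℝ).add hD
  obtain ⟨B, hB⟩ := CStarAlgebra.nonneg_iff_eq_star_mul_self.mp hM.nonneg
  let f : V ≃ Fin (Fintype.card V) := Fintype.equivFin V
  let p : V → EuclideanSpace ℝ (Fin (Fintype.card V)) := fun v =>
    WithLp.toLp 2 fun i => B (f.symm i) v
  have hin : ∀ u v, inner ℝ (p u) (p v) = (G.lapMatrix ℝ + D) u v := by
    intro u v
    rw [hB, Matrix.star_eq_conjTranspose, PiLp.inner_apply, Matrix.mul_apply, ← f.symm.sum_comp]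
    simp [p, mul_comm]
  have hd : ∀ u v, u ≠ v →
      ‖p u - p v‖ ^ 2 = 2 * (Fintype.card V + 1) + if G.Adj u v then 2 else 0 := by
    intro u v h
    rw [norm_sub_sq_real, ← real_inner_self_eq_norm_sq, ← real_inner_self_eq_norm_sq,
      hin, hin, hin]
    simp only [lapMatrix, degMatrix, D, Matrix.add_apply, Matrix.sub_apply,
      Matrix.diagonal_apply_eq, Matrix.diagonal_apply_ne _ h, adjMatrix_apply,
      SimpleGraph.irrefl, if_false]
    split_ifs <;> ring
  have hn : (0 : ℝ) ≤ Fintype.card V := Nat.cast_nonneg _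
  have hinj : Function.Injective p := by
    intro u v h
    by_contra hne
    have := hd u v hne
    rw [h, sub_self, norm_zero] at this
    split_ifs at this <;> linarith
  have hdist : ∀ u v, u ≠ v →
      ‖p u - p v‖ = √(2 * (Fintype.card V + 1) + if G.Adj u v then 2 else 0) := by
    intro u v h
    rw [← hd u v h, Real.sqrt_sq (norm_nonneg _)]
  refine ⟨_, ⟨p, hinj⟩, √(2 * (Fintype.card V + 1) + 2), √(2 * (Fintype.card V + 1) + 0),
    by positivity, by positivity, ?_, fun u v h => ⟨fun ha => ?_, fun ha => ?_⟩⟩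
  · rw [Ne, Real.sqrt_inj (by positivity) (by positivity)]
    linarith
  · exact (hdist u v h).trans (by rw [if_pos ha])
  · exact (hdist u v h).trans (by rw [if_neg ha])

/-- The Euclidean representation number of a finite graph: the smallest `m` such that the graph is
representable in `ℝ^m`. -/
noncomputable def euclideanRep {V : Type*} (G : SimpleGraph V) : ℕ :=
  sInf {m : ℕ | G.EuclideanRepresentable m}

/-- The number of connected components that are bipartite (an isolated vertex is such a
component). -/
noncomputable def numBipartiteComponents {V : Type*} (G : SimpleGraph V) : ℕ :=
  Nat.card {C : G.ConnectedComponent // C.toSimpleGraph.IsBipartite}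

end SimpleGraph

namespace SimpleGraph

open Module

/-! Map each edge to the indicator vector of its endpoints (`edgeVec`): two edges are then at
squared distance 2 if they meet and 4 if not. The span of these vectors has dimension `n - r`
(`finrank_span_edgeVec_add`), and they lie in the affine hyperplane of coordinate sum 2, which saves
one more dimension.

For the lower bound, compare an arbitrary representation `p` with `edgeVec` on coefficient vectors
of sum zero (`norm_mul_self_linearCombination_eq`). If `β² = 2α²`, the two are similar, so `p` needs
the same dimension. Otherwise `x ↦ ∑ x e • p e` is injective on the linear relations among the edge
vectors, a space of dimension `e - (n - r)`, which is at least `n - r` when `e ≥ 2(n - r)`. -/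

theorem Reachable.eq_of_forall_adj {V α : Type*} {G : SimpleGraph V} {f : V → α}
    (hf : ∀ u v, G.Adj u v → f u = f v) {u v : V} (h : G.Reachable u v) : f u = f v := by
  obtain ⟨p⟩ := h
  induction p with
  | nil => rfl
  | cons h _ ih => exact (hf _ _ h).trans ih

/-- A signing of the vertices, alternating along every edge, that vanishes exactly on the
non-bipartite components. -/
theorem exists_alternating_sign {V : Type*} (G : SimpleGraph V) :
    ∃ σ : V → ℝ, (∀ u v, G.Adj u v → σ u = - σ v) ∧
    (∀ v, (G.connectedComponentMk v).toSimpleGraph.IsBipartite → σ v * σ v = 1) ∧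
    ∀ v, ¬ (G.connectedComponentMk v).toSimpleGraph.IsBipartite → σ v = 0 := by
  classical
  have hc : ∀ C : G.ConnectedComponent, ∃ τ : V → ℝ,
      (C.toSimpleGraph.IsBipartite → (∀ v, τ v * τ v = 1) ∧
        ∀ u v, u ∈ C → v ∈ C → G.Adj u v → τ u = - τ v) ∧
      (¬ C.toSimpleGraph.IsBipartite → ∀ v, τ v = 0) := by
    intro C
    by_cases hC : C.toSimpleGraph.IsBipartite
    · obtain ⟨c⟩ := id hC
      refine ⟨fun v => if h : v ∈ C then (if c ⟨v, h⟩ = 0 then 1 else -1) else 1,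
        fun _ => ⟨fun v => ?_, fun u v hu hv huv => ?_⟩, fun h => absurd hC h⟩
      · dsimp only
        split_ifs <;> norm_num
      · have hne := c.valid ((C.toSimpleGraph_adj hu hv).2 huv)
        simp only [hu, hv, dif_pos]
        split_ifs with ha hb hb <;> first | norm_num; done | (exfalso; omega)
    · exact ⟨fun _ => 0, fun h => absurd h hC, fun _ _ => rfl⟩
  choose τ h1 h2 using hc
  refine ⟨fun v => τ (G.connectedComponentMk v) v, fun u v huv => ?_,
    fun v hv => (h1 _ hv).1 v, fun v hv => h2 _ hv v⟩
  have hC : G.connectedComponentMk u = G.connectedComponentMk v :=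
    ConnectedComponent.sound huv.reachable
  dsimp only
  rw [hC]
  by_cases hb : (G.connectedComponentMk v).toSimpleGraph.IsBipartite
  · exact (h1 _ hb).2 u v hC rfl huv
  · rw [h2 _ hb, h2 _ hb, neg_zero]

/-- `|y|` is constant on a component, so `y` has no zero there and its sign is a proper 2-colouring.
-/
theorem isBipartite_of_alternating {V : Type*} (G : SimpleGraph V) {y : V → ℝ}
    (hy : ∀ u v, G.Adj u v → y u = - y v) {v : V} (hv : y v ≠ 0) : (G.connectedComponentMk v).toSimpleGraph.IsBipartite := by
  classical
  have hne : ∀ w, w ∈ G.connectedComponentMk v → y w ≠ 0 := by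
    intro w hw h0
    have hr : G.Reachable w v := ConnectedComponent.exact hw
    have := hr.eq_of_forall_adj (f := fun w => |y w|)
      (fun a b hab => by simp [hy a b hab])
    simp [h0] at this
    exact hv (abs_eq_zero.1 this.symm)
  refine ⟨Coloring.mk (fun w => if 0 < y w then 0 else 1) ?_⟩
  rintro ⟨a, ha⟩ ⟨b, hb⟩ hab
  have hab' : G.Adj a b := (ConnectedComponent.toSimpleGraph_adj _ ha hb).1 hab
  have h1 := hy a b hab'
  have h2 := hne b hb
  dsimp only
  rcases lt_or_gt_of_ne h2 with h | h
  · rw [if_pos (by linarith), if_neg (by linarith)]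
    decide
  · rw [if_neg (by linarith), if_pos h]
    decide

section

/-! ### Edge vectors and their distances -/

variable {V : Type*} [Fintype V] (G : SimpleGraph V)

open Classical in
/-- The indicator vector of the endpoints of an edge. -/
noncomputable def edgeVec (e : G.edgeSet) : EuclideanSpace ℝ V :=
  WithLp.toLp 2 fun v => if v ∈ (e : Sym2 V) then 1 else 0

theorem inner_edgeVec {u v : V} (h : G.Adj u v) (y : EuclideanSpace ℝ V) :
    inner ℝ (G.edgeVec ⟨s(u, v), h⟩) y = y u + y v := by
  classical
  have hne : u ≠ v := h.ne
  have : ∀ w, y w * (if w = u ∨ w = v then (1 : ℝ) else 0)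
      = (if w = u then y w else 0) + (if w = v then y w else 0) := by
    intro w
    by_cases h1 : w = u <;> by_cases h2 : w = v <;> simp_all
  simp [edgeVec, PiLp.inner_apply, this, Finset.sum_add_distrib]

theorem edgeVec_norm_sub_mul_self (e f : G.edgeSet) :
    (G.lineGraph.Adj e f → ‖G.edgeVec e - G.edgeVec f‖ * ‖G.edgeVec e - G.edgeVec f‖ = 2) ∧
    (e ≠ f → ¬ G.lineGraph.Adj e f →
      ‖G.edgeVec e - G.edgeVec f‖ * ‖G.edgeVec e - G.edgeVec f‖ = 4) := by
  classical
  obtain ⟨⟨a, b⟩, hab⟩ := e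
  obtain ⟨⟨c, d⟩, hcd⟩ := f
  have hab' : G.Adj a b := hab
  have hcd' : G.Adj c d := hcd
  have h1 := hab'.ne
  have h2 := hcd'.ne
  have key : ‖G.edgeVec ⟨s(a, b), hab⟩ - G.edgeVec ⟨s(c, d), hcd⟩‖ *
      ‖G.edgeVec ⟨s(a, b), hab⟩ - G.edgeVec ⟨s(c, d), hcd⟩‖ =
      4 - 2 * ((if a = c ∨ a = d then 1 else 0) + (if b = c ∨ b = d then 1 else 0)) := by
    rw [← real_inner_self_eq_norm_mul_norm, inner_sub_left, inner_edgeVec G hab',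
      inner_edgeVec G hcd']
    by_cases h3 : a = c <;> by_cases h4 : a = d <;> by_cases h5 : b = c <;> by_cases h6 : b = d <;>
      simp_all [edgeVec, eq_comm] <;> norm_num
  rw [lineGraph_adj_iff_exists]
  constructor
  · rintro ⟨hne, hex⟩
    refine key.trans ?_
    clear key
    by_cases h3 : a = c <;> by_cases h4 : a = d <;> by_cases h5 : b = c <;> by_cases h6 : b = d <;>
      simp_all [eq_comm] <;> norm_num
  · intro hne hex
    refine key.trans ?_
    clear key
    by_cases h3 : a = c <;> by_cases h4 : a = d <;> by_cases h5 : b = c <;> by_cases h6 : b = d <;>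
      simp_all [eq_comm]

/-! ### Rank of the edge vectors -/

theorem mem_orthogonal_span_edgeVec_iff (y : EuclideanSpace ℝ V) :
    y ∈ (Submodule.span ℝ (Set.range G.edgeVec))ᗮ ↔ ∀ u v, G.Adj u v → y u = - y v := by
  rw [Submodule.mem_orthogonal]
  constructor
  · intro h u v huv
    have := h _ (Submodule.subset_span ⟨⟨s(u, v), huv⟩, rfl⟩)
    rw [inner_edgeVec] at this
    linarith
  · intro h x hx
    induction hx using Submodule.span_induction with
    | mem x hx =>
      obtain ⟨⟨⟨a, b⟩, hab⟩, rfl⟩ := hx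
      have := h a b hab
      have h2 := inner_edgeVec G (u := a) (v := b) hab y
      exact h2.trans (by linarith)
    | zero => simp
    | add x z _ _ hx hz => rw [inner_add_left, hx, hz, add_zero]
    | smul c x _ hx => rw [real_inner_smul_left, hx, mul_zero]

/-- The orthogonal complement consists of the alternating functions: one free scalar times `σ` on
each bipartite component, and zero elsewhere. -/
theorem finrank_orthogonal_span_edgeVec :
    finrank ℝ (Submodule.span ℝ (Set.range G.edgeVec))ᗮ = G.numBipartiteComponents := by
  classical
  obtain ⟨σ, h1, h2, h3⟩ := G.exists_alternating_sign
  let B := {C : G.ConnectedComponent // C.toSimpleGraph.IsBipartite}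
  have : Fintype B := Fintype.ofFinite B
  let Φ : (B → ℝ) →ₗ[ℝ] EuclideanSpace ℝ V :=
    { toFun := fun z => WithLp.toLp 2 fun v =>
        if h : (G.connectedComponentMk v).toSimpleGraph.IsBipartite then
          σ v * z ⟨G.connectedComponentMk v, h⟩ else 0
      map_add' := fun x y => by
        ext v
        by_cases h : (G.connectedComponentMk v).toSimpleGraph.IsBipartite <;> simp [h, mul_add]
      map_smul' := fun c y => by
        ext v
        by_cases h : (G.connectedComponentMk v).toSimpleGraph.IsBipartite <;> simp [h]
        ring }
  have hΦ : ∀ z v (h : (G.connectedComponentMk v).toSimpleGraph.IsBipartite),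
      Φ z v = σ v * z ⟨G.connectedComponentMk v, h⟩ := fun z v h => by simp [Φ, h]
  have hΦ0 : ∀ z v, ¬ (G.connectedComponentMk v).toSimpleGraph.IsBipartite → Φ z v = 0 :=
    fun z v h => by simp [Φ, h]
  have hinj : Function.Injective Φ := by
    intro z w hzw
    ext ⟨C, hC⟩
    induction C using ConnectedComponent.ind with | _ v
    have := congrArg (fun y : EuclideanSpace ℝ V => y v) hzw
    dsimp only at this
    rw [hΦ _ _ hC, hΦ _ _ hC] at this
    refine mul_left_cancel₀ (fun h0 => ?_) this
    simpa [h0] using h2 v hC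
  have hrange : LinearMap.range Φ = (Submodule.span ℝ (Set.range G.edgeVec))ᗮ := by
    ext y
    rw [mem_orthogonal_span_edgeVec_iff]
    constructor
    · rintro ⟨z, rfl⟩ u v huv
      have hC : G.connectedComponentMk u = G.connectedComponentMk v :=
        ConnectedComponent.sound huv.reachable
      by_cases hb : (G.connectedComponentMk v).toSimpleGraph.IsBipartite
      · rw [hΦ _ _ hb, hΦ _ _ (hC ▸ hb), h1 u v huv]
        simp [hC]
      · rw [hΦ0 _ _ hb, hΦ0 _ _ (hC ▸ hb), neg_zero]
    · intro hy
      -- `σ * y` is constant on components, so any representative gives the scalar; `σ² = 1` then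
      -- recovers `y`.
      refine ⟨fun C => σ C.1.out * y C.1.out, ?_⟩
      ext v
      by_cases hb : (G.connectedComponentMk v).toSimpleGraph.IsBipartite
      · rw [hΦ _ _ hb]
        have hr : G.Reachable (G.connectedComponentMk v).out v :=
          ConnectedComponent.exact (Quot.out_eq _)
        have := hr.eq_of_forall_adj (f := fun w => σ w * y w)
          (fun a b hab => by rw [h1 a b hab, hy a b hab]; ring)
        dsimp only at this ⊢
        rw [this, ← mul_assoc, h2 v hb, one_mul]
      · rw [hΦ0 _ _ hb]
        by_contra hne
        exact hb (G.isBipartite_of_alternating (y := y) hy (Ne.symm hne))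
  rw [← hrange, LinearMap.finrank_range_of_inj hinj, Module.finrank_fintype_fun_eq_card,
    numBipartiteComponents, Nat.card_eq_fintype_card]

theorem finrank_span_edgeVec_add :
    finrank ℝ (Submodule.span ℝ (Set.range G.edgeVec)) + G.numBipartiteComponents =
      Fintype.card V := by
  rw [← finrank_orthogonal_span_edgeVec, Submodule.finrank_add_finrank_orthogonal,
    finrank_euclideanSpace]

/-! ### Upper bound -/

theorem inner_one_edgeVec (e : G.edgeSet) :
    inner ℝ (G.edgeVec e) (WithLp.toLp 2 fun _ => (1 : ℝ)) = 2 := by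
  obtain ⟨⟨a, b⟩, hab⟩ := e
  exact (G.inner_edgeVec (u := a) (v := b) hab _).trans (by norm_num)

theorem euclideanRepresentable_lineGraph (e₀ : G.edgeSet) {m : ℕ}
    (hm : finrank ℝ (Submodule.span ℝ (Set.range G.edgeVec)) = m + 1) :
    G.lineGraph.EuclideanRepresentable m := by
  set R := Submodule.span ℝ (Set.range G.edgeVec)
  let φ : Module.Dual ℝ R :=
    (innerₛₗ ℝ (WithLp.toLp 2 fun _ => (1 : ℝ) : EuclideanSpace ℝ V)).comp R.subtype
  let q : G.edgeSet → R := fun e => ⟨G.edgeVec e, Submodule.subset_span ⟨e, rfl⟩⟩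
  have hq : ∀ e, φ (q e) = 2 := fun e => by
    change inner ℝ _ (G.edgeVec e) = 2
    rw [real_inner_comm, inner_one_edgeVec]
  have hφ : φ ≠ 0 := fun h => by simpa [h] using hq e₀
  have hdim : finrank ℝ (LinearMap.ker φ) = m := by
    have := Module.Dual.finrank_ker_add_one_of_ne_zero hφ
    omega
  let ι := ((stdOrthonormalBasis ℝ (LinearMap.ker φ)).reindex (finCongr hdim)).repr
  -- Translating by the vector of `e₀` moves the affine hyperplane `φ = 2` onto `ker φ`, of
  -- codimension one in the span.
  let ψ : G.edgeSet → LinearMap.ker φ := fun e => ⟨q e - q e₀, by simp [hq]⟩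
  let p : G.edgeSet → EuclideanSpace ℝ (Fin m) := fun e =>
    ι (ψ e)
  have hp : ∀ e f, ‖p e - p f‖ = ‖G.edgeVec e - G.edgeVec f‖ := by
    intro e f
    change ‖ι (ψ e) - ι (ψ f)‖ = _
    rw [← ι.map_sub, ι.norm_map, Submodule.coe_norm, Submodule.coe_norm]
    simp [ψ, q]
  have hn : ∀ e f, e ≠ f → (G.lineGraph.Adj e f → ‖p e - p f‖ = √2) ∧
      (¬ G.lineGraph.Adj e f → ‖p e - p f‖ = √4) := by
    intro e f hef
    have h := G.edgeVec_norm_sub_mul_self e f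
    rw [hp]
    refine ⟨fun ha => ?_, fun ha => ?_⟩
    · rw [← h.1 ha, Real.sqrt_mul_self (norm_nonneg _)]
    · rw [← h.2 hef ha, Real.sqrt_mul_self (norm_nonneg _)]
  refine ⟨⟨p, fun e f hef => ?_⟩, √2, √4, by positivity, by positivity, ?_, hn⟩
  · by_contra hne
    have h := hn e f hne
    rw [hef, sub_self, norm_zero] at h
    by_cases ha : G.lineGraph.Adj e f
    · exact absurd (h.1 ha) (by positivity)
    · exact absurd (h.2 ha) (by positivity)
  · rw [Ne, Real.sqrt_inj (by norm_num) (by norm_num)]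
    norm_num

/-! ### Lower bound -/

/-- When the coefficients sum to zero, the squared norm depends only on the squared distances. Off
the diagonal, those of `p` are the affine function of those of `edgeVec` sending 2 to `α²` and 4 to
`β²`; its constant term must be removed on the diagonal, which produces `∑ x e ^ 2`. -/
theorem norm_mul_self_linearCombination_eq [Fintype G.edgeSet] {F : Type*} [NormedAddCommGroup F]
    [InnerProductSpace ℝ F] {p : G.edgeSet → F} {α β : ℝ}
    (hp : ∀ e f, e ≠ f → (G.lineGraph.Adj e f → ‖p e - p f‖ = α) ∧
      (¬ G.lineGraph.Adj e f → ‖p e - p f‖ = β))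
    {x : G.edgeSet → ℝ} (hx : ∑ e, x e = 0) :
    ‖∑ e, x e • p e‖ * ‖∑ e, x e • p e‖ =
      (β ^ 2 - α ^ 2) / 2 * (‖∑ e, x e • G.edgeVec e‖ * ‖∑ e, x e • G.edgeVec e‖) +
      (2 * α ^ 2 - β ^ 2) / 2 * ∑ e, x e ^ 2 := by
  classical
  have hd : ∀ e f, x e * x f * (‖p e - p f‖ * ‖p e - p f‖) =
      (β ^ 2 - α ^ 2) / 2 *
        (x e * x f * (‖G.edgeVec e - G.edgeVec f‖ * ‖G.edgeVec e - G.edgeVec f‖)) +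
      (2 * α ^ 2 - β ^ 2) * (x e * x f) -
      (2 * α ^ 2 - β ^ 2) * (if e = f then x e * x f else 0) := by
    intro e f
    by_cases hef : e = f
    · subst hef
      simp
    · rw [if_neg hef]
      have h := G.edgeVec_norm_sub_mul_self e f
      by_cases ha : G.lineGraph.Adj e f
      · rw [(hp e f hef).1 ha, h.1 ha]
        ring
      · rw [(hp e f hef).2 ha, h.2 hef ha]
        ring
  rw [← real_inner_self_eq_norm_mul_norm, ← real_inner_self_eq_norm_mul_norm,
    inner_sum_smul_sum_smul_of_sum_eq_zero p hx p hx,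
    inner_sum_smul_sum_smul_of_sum_eq_zero G.edgeVec hx G.edgeVec hx]
  simp only [hd, Finset.sum_sub_distrib, Finset.sum_add_distrib, ← Finset.mul_sum, hx,
    Finset.sum_ite_eq, Finset.mem_univ, if_true, mul_zero, Finset.sum_const_zero]
  have : ∑ e, x e * x e = ∑ e, x e ^ 2 := Finset.sum_congr rfl fun e _ => (sq _).symm
  rw [this]
  ring

theorem EuclideanRepresentable.finrank_span_edgeVec_le {m : ℕ}
    (h : G.lineGraph.EuclideanRepresentable m) (e₀ : G.edgeSet)
    (he : 2 * finrank ℝ (Submodule.span ℝ (Set.range G.edgeVec)) ≤ Nat.card G.edgeSet) :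
    finrank ℝ (Submodule.span ℝ (Set.range G.edgeVec)) ≤ m + 1 := by
  classical
  have : Fintype G.edgeSet := Fintype.ofFinite _
  obtain ⟨p, α, β, hα, -, -, hp⟩ := h
  let T := Fintype.linearCombination ℝ p
  let N := Fintype.linearCombination ℝ G.edgeVec
  let φ : Module.Dual ℝ (G.edgeSet → ℝ) := ∑ e, LinearMap.proj e
  have hφ : ∀ x, φ x = ∑ e, x e := fun x => by simp [φ]
  have hT : ∀ x, φ x = 0 → ‖T x‖ * ‖T x‖ = (β ^ 2 - α ^ 2) / 2 * (‖N x‖ * ‖N x‖) +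
      (2 * α ^ 2 - β ^ 2) / 2 * ∑ e, x e ^ 2 := fun x hx =>
    G.norm_mul_self_linearCombination_eq hp ((hφ x).symm.trans hx)
  have hN : finrank ℝ (Submodule.span ℝ (Set.range G.edgeVec)) + finrank ℝ (LinearMap.ker N) =
      Nat.card G.edgeSet := by
    rw [← Fintype.range_linearCombination ℝ, LinearMap.finrank_range_add_finrank_ker,
      Module.finrank_fintype_fun_eq_card, Nat.card_eq_fintype_card]
  -- Pairing a linear relation with the all-ones vector gives twice its coefficient sum.
  have hker : ∀ x, N x = 0 → φ x = 0 := by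
    intro x hx
    have h0 : inner ℝ (N x) (WithLp.toLp 2 fun _ => (1 : ℝ)) = 0 := by rw [hx, inner_zero_left]
    simp only [N, Fintype.linearCombination_apply, sum_inner, real_inner_smul_left,
      inner_one_edgeVec, ← Finset.sum_mul] at h0
    rw [hφ]
    linarith
  by_cases hc : 2 * α ^ 2 - β ^ 2 = 0
  · have hφ0 : φ ≠ 0 := fun h => by
      have := hφ (Pi.single e₀ 1)
      simp [h] at this
    have h1 := Module.Dual.finrank_ker_add_one_of_ne_zero hφ0
    rw [Module.finrank_fintype_fun_eq_card, ← Nat.card_eq_fintype_card] at h1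
    have h2 := LinearMap.finrank_range_add_finrank_ker (T.domRestrict (LinearMap.ker φ))
    have h3 : finrank ℝ (LinearMap.range (T.domRestrict (LinearMap.ker φ))) ≤ m := by
      simpa using Submodule.finrank_le (LinearMap.range (T.domRestrict (LinearMap.ker φ)))
    have h4 : finrank ℝ (LinearMap.ker (T.domRestrict (LinearMap.ker φ))) ≤
        finrank ℝ (LinearMap.ker N) := by
      rw [← Submodule.finrank_map_subtype_eq]
      refine Submodule.finrank_mono ?_
      rintro _ ⟨⟨x, hx⟩, h0, rfl⟩
      have h0' : T x = 0 := h0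
      have hTx := hT x hx
      -- As `β² = 2α²`, the remaining coefficient is `α² / 2 ≠ 0`.
      rw [h0', hc, norm_zero, zero_div, zero_mul, zero_mul, add_zero, zero_eq_mul, or_iff_right
        (by nlinarith [sq_pos_of_pos hα]), mul_self_eq_zero, norm_eq_zero] at hTx
      exact hTx
    omega
  -- On `ker N` only the `∑ x e ^ 2` term survives, with nonzero coefficient.
  · have hinj : Function.Injective (T.domRestrict (LinearMap.ker N)) := by
      rw [← LinearMap.ker_eq_bot, LinearMap.ker_eq_bot']
      rintro ⟨x, hx⟩ h0
      have hx' : N x = 0 := hx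
      have h0' : T x = 0 := h0
      have := hT x (hker x hx')
      rw [hx', h0', norm_zero, norm_zero, mul_zero, mul_zero, zero_add, eq_comm, mul_eq_zero,
        or_iff_right (by simpa using hc), Finset.sum_eq_zero_iff_of_nonneg
        (fun _ _ => sq_nonneg _)] at this
      ext e
      simpa using this e (Finset.mem_univ e)
    have := LinearMap.finrank_le_finrank_of_injective hinj
    rw [finrank_euclideanSpace_fin] at this
    omega

end

end SimpleGraph

theorem mainTheorem7 {V : Type*} [Finite V] (G : SimpleGraph V) (n e r : ℕ)
    (hn : Nat.card V = n) (he : Nat.card G.edgeSet = e)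
    (hr : G.numBipartiteComponents = r) (he_pos : 1 ≤ e) :
    (G.lineGraph.euclideanRep : ℤ) ≤ (n : ℤ) - 1 - r ∧
      (2 * ((n : ℤ) - r) ≤ e → (G.lineGraph.euclideanRep : ℤ) = (n : ℤ) - 1 - r) := by
  have := Fintype.ofFinite V
  have hk := G.finrank_span_edgeVec_add
  rw [← Nat.card_eq_fintype_card, hn, hr] at hk
  have : Nonempty G.edgeSet := (Nat.card_pos_iff.1 (by omega)).1
  obtain ⟨e₀⟩ := this
  -- Having an edge makes the rank positive, so `m` is a genuine predecessor.
  obtain ⟨m, hm⟩ : ∃ m, Module.finrank ℝ (Submodule.span ℝ (Set.range G.edgeVec)) = m + 1 := by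
    refine Nat.exists_eq_add_one.2 (Nat.pos_of_ne_zero fun h0 => ?_)
    have hz : G.edgeVec e₀ = 0 := by
      have hb := Submodule.finrank_eq_zero.1 h0
      exact (Submodule.mem_bot ℝ).1 (hb ▸ Submodule.subset_span ⟨e₀, rfl⟩)
    simpa [hz] using G.inner_one_edgeVec e₀
  have hle : G.lineGraph.euclideanRep ≤ m :=
    Nat.sInf_le (G.euclideanRepresentable_lineGraph e₀ hm)
  refine ⟨by omega, fun h => ?_⟩
  have hrep : G.lineGraph.EuclideanRepresentable G.lineGraph.euclideanRep :=
    Nat.sInf_mem G.lineGraph.exists_euclideanRepresentable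
  have := SimpleGraph.EuclideanRepresentable.finrank_span_edgeVec_le G hrep e₀ (by omega)
  omega
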